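/- Let $R>0$. A (randomized) stream algorithm reads samples $X_1,X_2,\dots\in[-R,R]$ one at a time; after each number $t\ge 0$ of samples it decides, on the basis of $X_1,\dots,X_t$ and its internal coins, whether to halt, and when it halts, at a time $t^*$, it releases a real number $\hat\mu$ ($t^*=\infty$ if it never halts). It is $\varepsilon$-differentially private ($\varepsilon$-DP) if for any two streams $S,S'$ that differ in at most one timestep and every measurable set $\mathcal O$ of outputs (halting time and released number), $\Pr[\mathcal M(S)\in\mathcal O]\le e^{\varepsilon}\Pr[\mathcal M(S')\in\mathcal O]$. It is an $(\alpha,\beta)$-stopping rule if for every distribution on $[-R,R]$ with mean $\mu\neq 0$, run on i.i.d. samples from that distribution, it halts and releases $\hat\mu$ with $|\hat\mu-\mu|\le\alpha|\mu|$, except with probability less than $\beta$. Corollary 2. For every $\kappa<1$ there is a constant $c>0$, depending only on $\kappa$, such that for all $R>0$ and $\mu\ne 0$ with $|\mu|\le\kappa R$ there exists a distribution $\mathcal P$ on $[-R,R]$ with mean $\mu$ for which the following holds. For all $\varepsilon>0$, $\alpha\in(0,1)$ and $\beta\in(0,\tfrac14)$, every $\varepsilon$-DP $(\alpha,\beta)$-stopping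 rule, when run on i.i.d. samples from $\mathcal P$, uses with probability greater than $\tfrac14$ more than $$c\left(\frac{R^2\log(1/\beta)}{\alpha^2\mu^2}+\frac{R\log(1/\beta)}{\varepsilon\alpha|\mu|}\right)$$ samples, i.e. its sample complexity is $\Omega\left(\frac{R^2\log(1/\beta)}{\alpha^2\mu^2}+\frac{R\log(1/\beta)}{\varepsilon\alpha|\mu|}\right)$. -/

import Mathlib

open MeasureTheory ProbabilityTheory
open scoped ENNReal

noncomputable section

/-- An infinite stream of samples with values in `[-R, R]`; the sample seen in the `(i+1)`-st
timestep is `x i`. -/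
abbrev SampleStream (R : ℝ) : Type := ℕ → Set.Icc (-R) R

/-- Everything a stopping rule ever releases: `Sum.inr (t, v)` means that it halts after having
seen exactly `t` samples and then releases the number `v` (before that, its decision in every
timestep is "continue"); `Sum.inl ()` means that it never halts. -/
abbrev Outcome : Type := Unit ⊕ (ℕ × ℝ)

/-- The number of samples seen before halting, infinite if the run never halts. -/
def samplesUsed : Outcome → ℝ≥0∞
  | Sum.inl _ => ⊤
  | Sum.inr (t, _) => (t : ℝ≥0∞)

/-- A randomized algorithm that reads a stream of samples from `[-R, R]` one by one, decides after
each of them whether to halt, and releases a real number when it halts. It is given by the law of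
its outcome on every fixed stream, the randomness being that of the internal coins. -/
structure StreamAlgorithm (R : ℝ) where
  /-- The law of the outcome, as a function of the input stream. -/
  toKernel : Kernel (SampleStream R) Outcome
  isMarkov : IsMarkovKernel toKernel
  /-- The algorithm does not look ahead: what it does within the first `n` timesteps depends only
  on the first `n` samples. -/
  causal : ∀ (n : ℕ) (x y : SampleStream R), (∀ i < n, x i = y i) →
    ∀ O : Set Outcome, MeasurableSet O → (∀ o ∈ O, samplesUsed o ≤ (n : ℝ≥0∞)) →
      toKernel x O = toKernel y O

/-- Two streams are neighbours if they are identical except possibly in one timestep. -/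
def Neighbours {R : ℝ} (x y : SampleStream R) : Prop :=
  ∃ t : ℕ, ∀ s : ℕ, s ≠ t → x s = y s

/-- Event-level (pure) `ε`-differential privacy. -/
def IsDP {R : ℝ} (ε : ℝ) (M : StreamAlgorithm R) : Prop :=
  ∀ x y : SampleStream R, Neighbours x y → ∀ O : Set Outcome, MeasurableSet O →
    M.toKernel x O ≤ ENNReal.ofReal (Real.exp ε) * M.toKernel y O

/-- The mean of a distribution on `[-R, R]`. -/
def distMean {R : ℝ} (P : Measure (Set.Icc (-R) R)) : ℝ := ∫ x, (x : ℝ) ∂P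

/-- The law of the outcome of `M` on a stream of i.i.d. samples from `P`, over both the samples
and the internal coins of `M`. -/
def outcomeLaw {R : ℝ} (M : StreamAlgorithm R) (P : Measure (Set.Icc (-R) R))
    [IsProbabilityMeasure P] : Measure Outcome :=
  (Measure.infinitePi (fun _ : ℕ => P)).bind M.toKernel

/-- The run halts and releases a `(1 ± α)`-approximation of `μ`. -/
def Approximates (α μ : ℝ) (o : Outcome) : Prop :=
  ∃ (t : ℕ) (v : ℝ), o = Sum.inr (t, v) ∧ |v - μ| ≤ α * |μ|

/-- `M` is an `(α, β)`-stopping rule for `[-R, R]`: whatever the distribution on `[-R, R]` with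
nonzero mean `μ`, the probability that `M` fails to halt with a `(1 ± α)`-approximation of `μ` is
less than `β`. -/
def IsStoppingRule {R : ℝ} (α β : ℝ) (M : StreamAlgorithm R) : Prop :=
  ∀ (P : Measure (Set.Icc (-R) R)) [IsProbabilityMeasure P], distMean P ≠ 0 →
    (outcomeLaw M P).real {o | ¬ Approximates α (distMean P) o} < β

end

/-! Two-point method. Take P and Q to be coins on {R, -R} with means μ and μr, where r is just small
enough that no output approximates both. Let A be the event of halting within the sample budget with
an output good for μ; then Q(A) ≤ β, and P(A) ≤ 1/2 suffices, since P also fails with probability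
below 1/4. To pass from Q to P, find a weight L with E_P[L·1_A] ≤ Q(A). Weighted AM-GM gives P(A) ≤
Q(A)/(3β) + (4/3)β² E[L⁻²], and the moment is a product over samples (`sum_prod_weight_le_half`).
Put a = α|μ|/R, the order of the coins' bias gap. If a ≤ ε, L is the likelihood ratio, whose moment
grows by 1 + O(a²) per sample. If ε < a, couple the streams maximally and let L be exp(-ε) to the
number of disagreements, which group privacy permits; the moment grows by 1 + O(aε). -/

/-! ### Change of measure on finite products -/

/-- Weighted AM-GM for a likelihood ratio `L`, from `1 ≤ t + 4 / (27 t²)`. -/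
lemma le_tilt_add {β L G : ℝ} (hβ : 0 < β) (hL : 0 < L) (hG : 0 ≤ G) (hG1 : G ≤ 1) :
    G ≤ L * G / (3 * β) + 4 / 3 * β ^ 2 * (L ^ 2)⁻¹ := by
  have key : 1 ≤ L / (3 * β) + 4 / 3 * β ^ 2 * (L ^ 2)⁻¹ := by
    have h : L / (3 * β) + 4 / 3 * β ^ 2 * (L ^ 2)⁻¹ - 1
        = (L - 2 * β) ^ 2 * (L + β) / (3 * β * L ^ 2) := by
      field_simp
      ring
    have : 0 ≤ (L - 2 * β) ^ 2 * (L + β) / (3 * β * L ^ 2) := by positivity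
    linarith
  have h1 := mul_le_mul_of_nonneg_left key hG
  have h2 : G * (4 / 3 * β ^ 2 * (L ^ 2)⁻¹) ≤ 1 * (4 / 3 * β ^ 2 * (L ^ 2)⁻¹) :=
    mul_le_mul_of_nonneg_right hG1 (by positivity)
  have h3 : L * G / (3 * β) = G * (L / (3 * β)) := by ring
  linarith

/-- Average `le_tilt_add`: the tilted term contributes at most 1/3, the inverse moment at most
(4/3)(1/8) = 1/6. -/
lemma sum_prod_weight_le_half {ι C : Type*} [Fintype ι] [DecidableEq ι] [Fintype C] {w l : C → ℝ}
    {G : (ι → C) → ℝ} {β : ℝ} (hβ : 0 < β) (hw : ∀ c, 0 ≤ w c) (hl : ∀ c, 0 < l c)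
    (hG : ∀ c, 0 ≤ G c) (hG1 : ∀ c, G c ≤ 1)
    (htilt : ∑ c : ι → C, (∏ i, w (c i) * l (c i)) * G c ≤ β)
    (hmoment : β ^ 2 * (∑ c, w c * (l c ^ 2)⁻¹) ^ Fintype.card ι ≤ 1 / 8) :
    ∑ c : ι → C, (∏ i, w (c i)) * G c ≤ 1 / 2 := by
  have hpow : (∑ c, w c * (l c ^ 2)⁻¹) ^ Fintype.card ι
      = ∑ c : ι → C, ∏ i, w (c i) * (l (c i) ^ 2)⁻¹ := by
    rw [← Fintype.prod_sum (fun (_ : ι) c => w c * (l c ^ 2)⁻¹)]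
    simp
  have hle : ∑ c : ι → C, (∏ i, w (c i)) * G c
      ≤ ∑ c : ι → C, ((∏ i, w (c i) * l (c i)) * G c / (3 * β)
        + 4 / 3 * β ^ 2 * ∏ i, w (c i) * (l (c i) ^ 2)⁻¹) := by
    refine Finset.sum_le_sum fun c _ => ?_
    have h := mul_le_mul_of_nonneg_left
      (le_tilt_add (L := ∏ i, l (c i)) hβ (Finset.prod_pos fun i _ => hl _) (hG c) (hG1 c))
      (Finset.prod_nonneg fun i (_ : i ∈ Finset.univ) => hw (c i))
    refine h.trans (le_of_eq ?_)
    simp only [Finset.prod_mul_distrib, Finset.prod_inv_distrib, Finset.prod_pow]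
    ring
  rw [Finset.sum_add_distrib, ← Finset.sum_div, ← Finset.mul_sum, ← hpow] at hle
  have h1 : (∑ c : ι → C, (∏ i, w (c i) * l (c i)) * G c) / (3 * β) ≤ 1 / 3 := by
    rw [div_le_div_iff₀ (by positivity) (by norm_num)]
    linarith
  linarith

lemma sum_prod_weight_fst {ι C D : Type*} [Fintype ι] [DecidableEq ι] [Fintype C] [Fintype D]
    (w : C × D → ℝ) (g : (ι → C) → ℝ) :
    ∑ c : ι → C × D, (∏ i, w (c i)) * g (fun i => (c i).1)
      = ∑ x : ι → C, (∏ i, ∑ y, w (x i, y)) * g x := by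
  rw [← (Equiv.arrowProdEquivProdArrow ι (fun _ => C) (fun _ => D)).symm.sum_comp,
    Fintype.sum_prod_type]
  refine Finset.sum_congr rfl fun x _ => ?_
  rw [Fintype.prod_sum (fun i y => w (x i, y)), Finset.sum_mul]
  rfl

lemma sum_prod_weight_snd {ι C D : Type*} [Fintype ι] [DecidableEq ι] [Fintype C] [Fintype D]
    (w : C × D → ℝ) (g : (ι → D) → ℝ) :
    ∑ c : ι → C × D, (∏ i, w (c i)) * g (fun i => (c i).2)
      = ∑ y : ι → D, (∏ i, ∑ x, w (x, y i)) * g y := by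
  rw [← (Equiv.arrowProdEquivProdArrow ι (fun _ => C) (fun _ => D)).symm.sum_comp,
    Fintype.sum_prod_type_right]
  refine Finset.sum_congr rfl fun y _ => ?_
  rw [Fintype.prod_sum (fun i x => w (x, y i)), Finset.sum_mul]
  rfl

/-- The power is at most β^(-1/2), leaving β^(3/2) ≤ (1/4)^(3/2) = 1/8. -/
lemma sq_mul_pow_le_eighth {β δ s : ℝ} {n : ℕ} (hβ : 0 < β) (hβ4 : β < 1 / 4) (hs : 0 ≤ s)
    (hsδ : s ≤ 1 + δ) (hn : n * δ ≤ Real.log (1 / β) / 2) : β ^ 2 * s ^ n ≤ 1 / 8 := by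
  have h1 : s ^ n ≤ Real.exp (Real.log (1 / β) / 2) := by
    calc s ^ n ≤ Real.exp δ ^ n :=
          pow_le_pow_left₀ hs (by linarith [Real.add_one_le_exp δ]) n
      _ = Real.exp (n * δ) := (Real.exp_nat_mul δ n).symm
      _ ≤ _ := Real.exp_le_exp.2 hn
  have h2 : Real.exp (Real.log (1 / β) / 2) ^ 2 = 1 / β := by
    rw [← Real.exp_nat_mul]
    push_cast
    rw [mul_div_cancel₀ _ (by norm_num : (2 : ℝ) ≠ 0), Real.exp_log (by positivity)]
  refine (mul_le_mul_of_nonneg_left h1 (by positivity)).trans ?_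
  refine le_of_sq_le_sq ?_ (by norm_num)
  rw [mul_pow, h2]
  have : (β ^ 2) ^ 2 * (1 / β) = β ^ 3 := by field_simp
  rw [this]
  calc β ^ 3 ≤ (1 / 4) ^ 3 := pow_le_pow_left₀ hβ.le hβ4.le 3
    _ = (1 / 8) ^ 2 := by norm_num

/-! ### Coins, their coupling, and runs on coin streams -/

/-- The probability mass function of a coin that shows `true` with probability `p`. -/
def coinWeight (p : ℝ) (b : Bool) : ℝ := if b then p else 1 - p

/-- The maximal coupling of two coins. -/
def coinCoupling (p q : ℝ) : Bool × Bool → ℝ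
  | (true, true) => min p q
  | (true, false) => p - min p q
  | (false, true) => q - min p q
  | (false, false) => 1 - max p q

lemma coinCoupling_nonneg {p q : ℝ} (hp : 0 ≤ p) (hq : 0 ≤ q) (hp1 : p ≤ 1) (hq1 : q ≤ 1) :
    ∀ c, 0 ≤ coinCoupling p q c := by
  rintro ⟨_ | _, _ | _⟩ <;> simp [coinCoupling, *]

lemma sum_coinCoupling_fst (p q : ℝ) (x : Bool) :
    ∑ y, coinCoupling p q (x, y) = coinWeight p x := by
  cases x <;> simp [coinCoupling, coinWeight]
  linarith [min_add_max p q]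

lemma sum_coinCoupling_snd (p q : ℝ) (y : Bool) :
    ∑ x, coinCoupling p q (x, y) = coinWeight q y := by
  cases y <;> simp [coinCoupling, coinWeight]
  linarith [min_add_max p q]

/-- The stream that starts with `u` and `v` as prescribed by `b` and goes on with `v`. -/
def blockStream {X : Type*} {n : ℕ} (u v : X) (b : Finset.range n → Bool) : ℕ → X :=
  fun i => if h : i ∈ Finset.range n then cond (b ⟨i, h⟩) u v else v

/-- Only the first `n` coordinates matter, so the arbitrary tail of `blockStream` is harmless. -/
lemma lintegral_infinitePi_bernoulli {X : Type*} [MeasurableSpace X] (u v : X)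
    (p : unitInterval) {n : ℕ} {f : (ℕ → X) → ℝ≥0∞} (hf : Measurable f)
    (hdep : ∀ x y, (∀ i < n, x i = y i) → f x = f y) :
    ∫⁻ x, f x ∂(Measure.infinitePi fun _ : ℕ => bernoulliMeasure u v p)
      = ∑ b : Finset.range n → Bool,
        f (blockStream u v b) * ENNReal.ofReal (∏ i, coinWeight p (b i)) := by
  have hmap : (Measure.infinitePi fun _ : ℕ => bernoulliMeasure u v p)
      = (Measure.infinitePi fun _ : ℕ => bernoulliMeasure true false p).map
        (fun x i => cond (x i) u v) := by
    rw [Measure.infinitePi_map_pi (f := fun _ b => cond b u v) _ (fun _ => measurable_of_finite _)]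
    congr 1
    funext _
    rw [map_bernoulliMeasure' _ _ (measurable_of_finite _)]
    rfl
  have hmeas : Measurable fun (x : ℕ → Bool) i => cond (x i) u v :=
    measurable_pi_lambda _ fun i => (measurable_of_finite fun b : Bool => cond b u v).comp
      (measurable_pi_apply i)
  rw [hmap, lintegral_map hf hmeas]
  have hres : ∀ x : ℕ → Bool, f (fun i => cond (x i) u v)
      = f (blockStream u v ((Finset.range n).restrict x)) := by
    intro x
    refine hdep _ _ fun i hi => ?_
    simp [blockStream, hi]
  simp_rw [hres]
  rw [lintegral_restrict_infinitePi (X := fun _ : ℕ => Bool) (μ := fun _ => _)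
    (f := fun b : Finset.range n → Bool => f (blockStream u v b)) (measurable_of_finite _),
    lintegral_fintype]
  refine Finset.sum_congr rfl fun b _ => ?_
  congr 1
  rw [Measure.pi_singleton, ENNReal.ofReal_prod_of_nonneg]
  · refine Finset.prod_congr rfl fun i _ => ?_
    cases b i <;> simp [coinWeight, ENNReal.ofReal, ← NNReal.coe_inj, p.2.1, p.2.2]
  · intro i _
    unfold coinWeight
    split_ifs <;> linarith [p.2.1, p.2.2]

instance {R : ℝ} (M : StreamAlgorithm R) : IsMarkovKernel M.toKernel := M.isMarkov

instance {R : ℝ} (M : StreamAlgorithm R) (P : Measure (Set.Icc (-R) R)) [IsProbabilityMeasure P] :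
    IsProbabilityMeasure (outcomeLaw M P) := by
  unfold outcomeLaw
  infer_instance

lemma outcomeLaw_bernoulli_real {R : ℝ} (M : StreamAlgorithm R) (u v : Set.Icc (-R) R)
    (p : unitInterval) {n : ℕ} {A : Set Outcome} (hA : MeasurableSet A)
    (hn : ∀ o ∈ A, samplesUsed o ≤ (n : ℝ≥0∞)) :
    (outcomeLaw M (bernoulliMeasure u v p)).real A
      = ∑ b : Finset.range n → Bool,
        (∏ i, coinWeight p (b i)) * (M.toKernel (blockStream u v b)).real A := by
  rw [measureReal_def, outcomeLaw, Measure.bind_apply hA M.toKernel.measurable.aemeasurable,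
    lintegral_infinitePi_bernoulli u v p (M.toKernel.measurable_coe hA)
      (fun x y hxy => M.causal n x y hxy A hA hn),
    ENNReal.toReal_sum (fun b _ => ENNReal.mul_ne_top (measure_ne_top _ _) ENNReal.ofReal_ne_top)]
  refine Finset.sum_congr rfl fun b _ => ?_
  rw [ENNReal.toReal_mul, ENNReal.toReal_ofReal, mul_comm, measureReal_def]
  refine Finset.prod_nonneg fun i _ => ?_
  unfold coinWeight
  split_ifs <;> linarith [p.2.1, p.2.2]

/-! ### Transfer between two coins: likelihood and privacy -/

/-- Group privacy along the hybrids of two streams. -/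
lemma IsDP.prod_mul_real_le {R ε : ℝ} {M : StreamAlgorithm R} (hM : IsDP ε M)
    {O : Set Outcome} (hO : MeasurableSet O) {l : ℕ → ℝ} {x y : SampleStream R}
    (hl : ∀ i, l i = 1 ∧ x i = y i ∨ l i = Real.exp (-ε)) (n : ℕ) :
    (∏ i ∈ Finset.range n, l i) * (M.toKernel x).real O
      ≤ (M.toKernel fun i => if i < n then y i else x i).real O := by
  have hl0 : ∀ i, 0 ≤ l i := fun i => by
    rcases hl i with h | h
    · simp [h.1]
    · simp [h, Real.exp_nonneg]
  induction n with
  | zero => simp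
  | succ n ih =>
    rw [Finset.prod_range_succ, mul_right_comm, mul_comm]
    refine (mul_le_mul_of_nonneg_left ih (hl0 n)).trans ?_
    rcases hl n with ⟨h1, h⟩ | h
    · rw [h1, one_mul]
      refine le_of_eq ?_
      congr 2
      funext i
      rcases lt_trichotomy i n with hi | rfl | hi
      · simp [hi, Nat.lt_succ_of_lt hi]
      · simp [h]
      · simp [not_lt.2 hi.le, not_lt.2 (Nat.succ_le_of_lt hi)]
    · rw [h, Real.exp_neg, inv_mul_le_iff₀ (Real.exp_pos ε)]
      have := hM (fun i => if i < n then y i else x i) (fun i => if i < n + 1 then y i else x i)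
        ⟨n, fun i hi => by
          have : i < n + 1 ↔ i < n := by omega
          simp [this]⟩ O hO
      have := ENNReal.toReal_mono (ENNReal.mul_ne_top ENNReal.ofReal_ne_top (measure_ne_top _ _))
        this
      rwa [ENNReal.toReal_mul, ENNReal.toReal_ofReal (Real.exp_nonneg ε)] at this

lemma outcomeLaw_le_half_of_likelihood {R β δ : ℝ} (M : StreamAlgorithm R) (u v : Set.Icc (-R) R)
    {p q : unitInterval} (hp : (p : ℝ) ∈ Set.Ioo 0 1) (hq : (q : ℝ) ∈ Set.Ioo 0 1) {n : ℕ}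
    {A : Set Outcome} (hA : MeasurableSet A) (hn : ∀ o ∈ A, samplesUsed o ≤ (n : ℝ≥0∞))
    (hβ : 0 < β) (hβ4 : β < 1 / 4) (hQ : (outcomeLaw M (bernoulliMeasure u v q)).real A ≤ β)
    (hδ : (p : ℝ) ^ 3 / q ^ 2 + (1 - p) ^ 3 / (1 - q) ^ 2 ≤ 1 + δ)
    (hnδ : n * δ ≤ Real.log (1 / β) / 2) :
    (outcomeLaw M (bernoulliMeasure u v p)).real A ≤ 1 / 2 := by
  have pos : ∀ {r : ℝ}, r ∈ Set.Ioo (0 : ℝ) 1 → ∀ b, 0 < coinWeight r b := by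
    intro r hr b
    unfold coinWeight
    split_ifs <;> linarith [hr.1, hr.2]
  have hp1 : 0 < 1 - (p : ℝ) := by linarith [hp.2]
  have hq1 : 0 < 1 - (q : ℝ) := by linarith [hq.2]
  have hp0 : 0 < (p : ℝ) := hp.1
  have hq0 : 0 < (q : ℝ) := hq.1
  rw [outcomeLaw_bernoulli_real M u v _ hA hn] at hQ ⊢
  refine sum_prod_weight_le_half (l := fun b => coinWeight q b / coinWeight p b) hβ
    (fun b => (pos hp b).le) (fun b => div_pos (pos hq b) (pos hp b))
    (fun _ => measureReal_nonneg) (fun _ => measureReal_le_one) ?_ ?_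
  · simpa only [mul_div_cancel₀ _ (pos hp _).ne'] using hQ
  · refine sq_mul_pow_le_eighth (δ := δ) hβ hβ4
      (Finset.sum_nonneg fun b _ => mul_nonneg (pos hp b).le (by positivity)) ?_ (by simpa using hnδ)
    refine le_trans (le_of_eq ?_) hδ
    simp only [Fintype.sum_bool, coinWeight, if_true, Bool.false_eq_true, if_false]
    field_simp

lemma outcomeLaw_le_half_of_coupling {R β δ ε : ℝ} {M : StreamAlgorithm R} (hM : IsDP ε M)
    (u v : Set.Icc (-R) R) {p q : unitInterval} {n : ℕ}
    {A : Set Outcome} (hA : MeasurableSet A) (hn : ∀ o ∈ A, samplesUsed o ≤ (n : ℝ≥0∞))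
    (hβ : 0 < β) (hβ4 : β < 1 / 4) (hQ : (outcomeLaw M (bernoulliMeasure u v q)).real A ≤ β)
    (hδ : |(p : ℝ) - q| * (Real.exp ε ^ 2 - 1) ≤ δ) (hnδ : n * δ ≤ Real.log (1 / β) / 2) :
    (outcomeLaw M (bernoulliMeasure u v p)).real A ≤ 1 / 2 := by
  have hw := coinCoupling_nonneg p.2.1 q.2.1 p.2.2 q.2.2
  -- Each disagreement costs one use of privacy.
  let l : Bool × Bool → ℝ := fun c => if c.1 = c.2 then 1 else Real.exp (-ε)
  have hl : ∀ c, 0 < l c := fun c => by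
    simp only [l]
    split_ifs <;> positivity
  rw [outcomeLaw_bernoulli_real M u v _ hA hn] at hQ ⊢
  simp_rw [← sum_coinCoupling_fst p q]
  simp_rw [← sum_coinCoupling_snd p q] at hQ
  rw [← sum_prod_weight_fst]
  rw [← sum_prod_weight_snd] at hQ
  refine sum_prod_weight_le_half (l := l) hβ hw hl
    (fun _ => measureReal_nonneg) (fun _ => measureReal_le_one) (le_trans ?_ hQ) ?_
  · refine Finset.sum_le_sum fun c _ => ?_
    rw [Finset.prod_mul_distrib, mul_assoc]
    refine mul_le_mul_of_nonneg_left ?_ (Finset.prod_nonneg fun i _ => hw _)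
    -- Beyond the block both streams equal `v`, so the default factor 1 is admissible.
    let l' : ℕ → ℝ := fun i => if h : i ∈ Finset.range n then l (c ⟨i, h⟩) else 1
    have hprod : ∏ i, l (c i) = ∏ i ∈ Finset.range n, l' i := by
      rw [← Finset.prod_coe_sort (Finset.range n) l']
      refine Finset.prod_congr rfl fun i _ => ?_
      simp only [l', i.2, dif_pos]
    rw [hprod]
    refine (hM.prod_mul_real_le hA (x := blockStream u v fun i => (c i).1)
      (y := blockStream u v fun i => (c i).2) (l := l') ?_ n).trans (le_of_eq ?_)
    · intro i
      by_cases hi : i ∈ Finset.range n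
      · by_cases hc : (c ⟨i, hi⟩).1 = (c ⟨i, hi⟩).2
        · left
          simp only [l', l, blockStream, dif_pos hi, hc, if_true, and_self]
        · right
          simp only [l', l, dif_pos hi, hc, if_false]
      · left
        simp only [l', blockStream, dif_neg hi, and_self]
    · congr 2
      funext i
      by_cases hi : i < n <;> simp [blockStream, hi]
  · refine sq_mul_pow_le_eighth (δ := δ) hβ hβ4
      (Finset.sum_nonneg fun c _ => mul_nonneg (hw c) (by positivity)) ?_ (by simpa using hnδ)
    -- The maximal coupling disagrees with probability exactly |p - q|.
    have hmin : |(p : ℝ) - q| = p + q - 2 * min (p : ℝ) q := by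
      rw [← max_sub_min_eq_abs']
      linarith [min_add_max (p : ℝ) q]
    have hsum : ∑ c, coinCoupling p q c * (l c ^ 2)⁻¹
        = 1 + |(p : ℝ) - q| * (Real.exp ε ^ 2 - 1) := by
      rw [hmin]
      simp only [Fintype.sum_prod_type, Fintype.sum_bool, coinCoupling, l, if_true, if_false,
        Real.exp_neg, inv_pow, inv_inv, reduceCtorEq, one_pow, inv_one]
      linear_combination -(min_add_max (p : ℝ) q)
    rw [hsum]
    linarith

/-! ### Moment estimates and the two regimes -/

lemma add_cube_div_sq_le {y η θ : ℝ} (hθ : 0 < θ) (hθ1 : θ ≤ 1) (hy : θ ≤ y) (hη : |η| ≤ 1) :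
    (y + η) ^ 3 / y ^ 2 ≤ y + 3 * η + 4 * (η ^ 2 / θ ^ 2) := by
  have hy0 : 0 < y := hθ.trans_le hy
  have h1 : (y + η) ^ 3 / y ^ 2 = y + 3 * η + 3 * (η ^ 2 / y) + η * (η ^ 2 / y ^ 2) := by
    field_simp
    ring
  have h2 : η ^ 2 / y ≤ η ^ 2 / θ ^ 2 :=
    div_le_div_of_nonneg_left (sq_nonneg η) (by positivity) (by nlinarith)
  have h3 : η ^ 2 / y ^ 2 ≤ η ^ 2 / θ ^ 2 :=
    div_le_div_of_nonneg_left (sq_nonneg η) (by positivity) (by nlinarith)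
  have h4 : η * (η ^ 2 / y ^ 2) ≤ 1 * (η ^ 2 / y ^ 2) :=
    mul_le_mul_of_nonneg_right (le_of_abs_le hη) (by positivity)
  linarith

/-- The left side is E_P[(dQ/dP)⁻²] for one toss. The first-order terms of the two faces cancel, so
the excess is quadratic in p - q. -/
lemma likelihood_third_moment_le {p q θ : ℝ} (hθ : 0 < θ) (hθ1 : θ ≤ 1) (hq : θ ≤ q)
    (hq' : θ ≤ 1 - q) (h : |p - q| ≤ 1) :
    p ^ 3 / q ^ 2 + (1 - p) ^ 3 / (1 - q) ^ 2 ≤ 1 + 8 * ((p - q) ^ 2 / θ ^ 2) := by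
  have h1 := add_cube_div_sq_le hθ hθ1 hq h
  have h2 := add_cube_div_sq_le hθ hθ1 hq' (by rwa [← abs_neg, neg_sub] at h : |q - p| ≤ 1)
  rw [add_sub_cancel] at h1
  rw [show 1 - q + (q - p) = 1 - p by ring, show (q - p) ^ 2 = (p - q) ^ 2 by ring] at h2
  linarith

lemma exp_sq_sub_one_le {ε : ℝ} (h0 : 0 ≤ ε) (h1 : ε ≤ 1) : Real.exp ε ^ 2 - 1 ≤ 8 * ε := by
  have h := Real.abs_exp_sub_one_sub_id_le (x := ε) (by rwa [abs_of_nonneg h0])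
  have h2 : Real.exp ε ≤ 1 + 2 * ε := by nlinarith [le_of_abs_le h]
  nlinarith [Real.exp_pos ε]

/-- If `p` and `q` are closer than the accuracy `a` asks for, then a private algorithm cannot
tell the two coins apart from few samples. -/
lemma outcomeLaw_le_half {R β ε θ a : ℝ} {M : StreamAlgorithm R} (hM : IsDP ε M) (hε : 0 < ε)
    (u v : Set.Icc (-R) R) {p q : unitInterval} (hθ : 0 < θ) (hθ1 : θ ≤ 1 / 2)
    (hp : θ ≤ p) (hp' : θ ≤ 1 - p) (hq : θ ≤ q) (hq' : θ ≤ 1 - q) (ha : 0 < a) (ha1 : a ≤ 1)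
    (hpq : |(p : ℝ) - q| ≤ 3 / 2 * a) {n : ℕ}
    {A : Set Outcome} (hA : MeasurableSet A) (hn : ∀ o ∈ A, samplesUsed o ≤ (n : ℝ≥0∞))
    (hβ : 0 < β) (hβ4 : β < 1 / 4) (hQ : (outcomeLaw M (bernoulliMeasure u v q)).real A ≤ β)
    (hnT : n ≤ θ ^ 2 / 72 * (Real.log (1 / β) / a ^ 2 + Real.log (1 / β) / (ε * a))) :
    (outcomeLaw M (bernoulliMeasure u v p)).real A ≤ 1 / 2 := by
  have hL : 0 ≤ Real.log (1 / β) :=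
    Real.log_nonneg (by rw [le_div_iff₀ hβ]; linarith)
  set L := Real.log (1 / β)
  -- The larger of 1/a² and 1/(εa) decides the method. The 72 makes nδ ≤ L/2 in the first case: 18 =
  -- 8·(3/2)² and 18/72 = 1/4, doubled because a/ε ≤ 1.
  rcases le_or_gt a ε with hc | hc
  · refine outcomeLaw_le_half_of_likelihood (δ := 18 * (a ^ 2 / θ ^ 2)) M u v
      ⟨by linarith, by linarith⟩ ⟨by linarith, by linarith⟩ hA hn hβ hβ4 hQ ?_ ?_
    · refine (likelihood_third_moment_le hθ (by linarith) hq hq' ?_).trans ?_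
      · exact abs_sub_le_iff.2 ⟨by linarith, by linarith⟩
      · have h1 : ((p : ℝ) - q) ^ 2 ≤ (3 / 2 * a) ^ 2 := sq_le_sq' (neg_le_of_abs_le hpq)
          (le_of_abs_le hpq)
        have h2 := div_le_div_of_nonneg_right h1 (sq_nonneg θ)
        have h3 : (3 / 2 * a) ^ 2 / θ ^ 2 = 9 / 4 * (a ^ 2 / θ ^ 2) := by ring
        linarith
    · refine (mul_le_mul_of_nonneg_right hnT (by positivity)).trans ?_
      have h1 : θ ^ 2 / 72 * (L / a ^ 2 + L / (ε * a)) * (18 * (a ^ 2 / θ ^ 2))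
          = L / 4 * (1 + a / ε) := by
        field_simp
        ring
      have h2 : a / ε ≤ 1 := (div_le_one hε).2 hc
      rw [h1]
      nlinarith
  · refine outcomeLaw_le_half_of_coupling (δ := 12 * (a * ε)) hM u v hA hn hβ hβ4 hQ ?_ ?_
    · have h1 := mul_le_mul hpq (exp_sq_sub_one_le hε.le (by linarith))
        (by nlinarith [Real.add_one_le_exp ε]) (by positivity)
      linarith
    · refine (mul_le_mul_of_nonneg_right hnT (by positivity)).trans ?_
      have h1 : θ ^ 2 / 72 * (L / a ^ 2 + L / (ε * a)) * (12 * (a * ε))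
          = θ ^ 2 * L / 6 * (ε / a + 1) := by
        field_simp
        ring
      have h2 : ε / a + 1 ≤ 2 := by linarith [(div_le_one ha).2 hc.le]
      have h3 : θ ^ 2 * L ≤ 1 * L := mul_le_mul_of_nonneg_right (by nlinarith) hL
      have h4 := mul_le_mul_of_nonneg_left h2 (by positivity : 0 ≤ θ ^ 2 * L / 6)
      rw [h1]
      linarith

/-! ### The two-point argument -/

lemma measurableSet_approximates_within (n : ℕ) (α μ : ℝ) :
    MeasurableSet {o : Outcome | samplesUsed o ≤ (n : ℝ≥0∞) ∧ Approximates α μ o} := by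
  have h : {o : Outcome | samplesUsed o ≤ (n : ℝ≥0∞) ∧ Approximates α μ o}
      = Sum.inr '' (Set.Iic n ×ˢ {v : ℝ | |v - μ| ≤ α * |μ|}) := by
    ext o
    simp only [Set.mem_ofPred_eq, Set.mem_image, Set.mem_prod, Set.mem_Iic, Approximates]
    constructor
    · rintro ⟨h, t, v, rfl, hv⟩
      exact ⟨(t, v), ⟨by simpa [samplesUsed] using h, hv⟩, rfl⟩
    · rintro ⟨⟨t, v⟩, ⟨ht, hv⟩, rfl⟩
      exact ⟨by simpa [samplesUsed] using ht, t, v, rfl, hv⟩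
  rw [h, measurableSet_inr_image]
  exact measurableSet_Iic.prod
    (measurableSet_le (by fun_prop) measurable_const)

lemma not_approximates_both {α μ r : ℝ} (hμ : μ ≠ 0) (hr : 0 < r) (h : r * (1 + α) < 1 - α)
    {o : Outcome} (ho : Approximates α μ o) : ¬ Approximates α (μ * r) o := by
  rintro ⟨t, v, rfl, hv⟩
  obtain ⟨t', v', h', hv'⟩ := ho
  obtain ⟨-, rfl⟩ := Prod.mk.inj (Sum.inr.inj h')
  have hμ' : 0 < |μ| := abs_pos.2 hμ
  have h1 : |μ - μ * r| ≤ |v - μ * r| + |v - μ| := by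
    have := abs_sub_le μ v (μ * r)
    rw [abs_sub_comm μ v] at this
    linarith
  rw [← mul_one_sub, abs_mul] at h1
  rw [abs_mul, abs_of_pos hr] at hv
  have h2 := mul_le_mul_of_nonneg_left (le_abs_self (1 - r)) hμ'.le
  nlinarith

lemma distMean_bernoulli {R : ℝ} (hR : 0 < R) (m : ℝ) {p : unitInterval}
    (hp : (p : ℝ) = (1 + m / R) / 2) :
    distMean (bernoulliMeasure (⟨R, by simp [hR.le]⟩ : Set.Icc (-R) R) ⟨-R, by simp [hR.le]⟩ p)
      = m := by
  rw [distMean, integral_bernoulliMeasure, hp]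
  simp only [smul_eq_mul]
  field_simp
  ring

theorem corollary2 (κ : ℝ) (hκ : κ < 1) :
    ∃ c : ℝ, 0 < c ∧ ∀ R μ : ℝ, 0 < R → μ ≠ 0 → |μ| ≤ κ * R →
      ∃ (P : Measure (Set.Icc (-R) R)) (_ : IsProbabilityMeasure P), distMean P = μ ∧
        ∀ ε α β : ℝ, 0 < ε → 0 < α → α < 1 → 0 < β → β < 1 / 4 →
          ∀ M : StreamAlgorithm R, IsDP ε M → IsStoppingRule α β M →
            1 / 4 < (outcomeLaw M P).real
              {o | ENNReal.ofReal
                  (c * (R ^ 2 * Real.log (1 / β) / (α ^ 2 * μ ^ 2)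
                    + R * Real.log (1 / β) / (ε * α * |μ|))) < samplesUsed o} := by
  have hθ : 0 < (1 - κ) / 2 := by linarith
  -- Means of size at most κR keep the coin's bias in [θ, 1 - θ].
  set θ := (1 - κ) / 2 with hθdef
  refine ⟨θ ^ 2 / 72, by positivity, fun R μ hR hμ hμκ => ?_⟩
  have hμ0 : 0 < |μ| := abs_pos.2 hμ
  have hκ0 : 0 < κ := pos_of_mul_pos_left (hμ0.trans_le hμκ) hR.le
  have coin : ∀ m : ℝ, |m| ≤ |μ| → θ ≤ (1 + m / R) / 2 ∧ θ ≤ 1 - (1 + m / R) / 2 := by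
    intro m hm
    have h : |m / R| ≤ κ := by
      rw [abs_div, abs_of_pos hR, div_le_iff₀ hR]
      exact hm.trans hμκ
    rw [abs_le] at h
    constructor <;> linarith
  obtain ⟨hp, hp'⟩ := coin μ le_rfl
  let u : Set.Icc (-R) R := ⟨R, by simp [hR.le]⟩
  let v : Set.Icc (-R) R := ⟨-R, by simp [hR.le]⟩
  let p : unitInterval := ⟨(1 + μ / R) / 2, by linarith, by linarith⟩
  have hmeanP : distMean (bernoulliMeasure u v p) = μ := distMean_bernoulli hR μ rfl
  refine ⟨bernoulliMeasure u v p, inferInstance, hmeanP, ?_⟩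
  intro ε α β hε hα hα1 hβ hβ4 M hM hS
  have hL : 0 ≤ Real.log (1 / β) :=
    Real.log_nonneg (by rw [le_div_iff₀ hβ]; linarith)
  set T := θ ^ 2 / 72 * (R ^ 2 * Real.log (1 / β) / (α ^ 2 * μ ^ 2)
    + R * Real.log (1 / β) / (ε * α * |μ|)) with hT
  have hT0 : 0 ≤ T := by positivity
  -- Any ratio below (1 - α)/(1 + α) separates the targets; 2α makes this strict while keeping 1 - r
  -- ≤ 3α.
  let r := (1 - α) / (1 + 2 * α)
  have hr : 0 < r := div_pos (by linarith) (by linarith)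
  have hr1 : 1 - r = 3 * α / (1 + 2 * α) := by
    simp only [r]
    field_simp
    ring
  have hr0 : 0 ≤ 1 - r := by rw [hr1]; positivity
  have hr3 : 1 - r ≤ 3 * α := by
    rw [hr1]
    exact div_le_self (by positivity) (by linarith)
  have hrα : r * (1 + α) < 1 - α := by
    simp only [r]
    rw [div_mul_eq_mul_div, div_lt_iff₀ (by linarith)]
    nlinarith
  obtain ⟨hq, hq'⟩ := coin (μ * r) (by
    rw [abs_mul, abs_of_pos hr]
    nlinarith)
  let q : unitInterval := ⟨(1 + μ * r / R) / 2, by linarith, by linarith⟩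
  have hmeanQ : distMean (bernoulliMeasure u v q) = μ * r := distMean_bernoulli hR (μ * r) rfl
  let A : Set Outcome := {o | samplesUsed o ≤ (⌊T⌋₊ : ℝ≥0∞) ∧ Approximates α μ o}
  have hQ : (outcomeLaw M (bernoulliMeasure u v q)).real A ≤ β := by
    have h := hS (bernoulliMeasure u v q) (by rw [hmeanQ]; positivity)
    rw [hmeanQ] at h
    exact (measureReal_mono fun o ho => not_approximates_both hμ hr hrα ho.2).trans h.le
  have hα' : α * |μ| / R ≤ 1 := by
    rw [div_le_one hR]
    nlinarith
  have hP := outcomeLaw_le_half (a := α * |μ| / R) hM hε u v (p := p) (q := q) (n := ⌊T⌋₊) hθ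
    (by linarith) hp hp' hq hq' (by positivity) hα' ?_
    (measurableSet_approximates_within _ α μ) (fun o ho => ho.1) hβ hβ4 hQ ?_
  · have hfail := hS (bernoulliMeasure u v p) (by rwa [hmeanP])
    rw [hmeanP] at hfail
    -- A run is good and early, bad, or late; the first two have probability at most 1/2 and below
    -- 1/4.
    have hcover : (Set.univ : Set Outcome)
        ⊆ A ∪ {o | ¬ Approximates α μ o} ∪ {o | ENNReal.ofReal T < samplesUsed o} := by
      intro o _
      by_cases h1 : ENNReal.ofReal T < samplesUsed o
      · exact Or.inr h1
      by_cases h2 : Approximates α μ o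
      · refine Or.inl (Or.inl ⟨?_, h2⟩)
        obtain ⟨t, w, rfl, -⟩ := h2
        have h3 : (t : ℝ≥0∞) ≤ ENNReal.ofReal T := not_lt.1 h1
        rw [← ENNReal.ofReal_natCast, ENNReal.ofReal_le_ofReal_iff hT0] at h3
        exact Nat.cast_le.2 (Nat.le_floor h3)
      · exact Or.inl (Or.inr h2)
    have h1 := measureReal_mono (μ := outcomeLaw M (bernoulliMeasure u v p)) hcover
    rw [probReal_univ] at h1
    have h2 := measureReal_union_le (μ := outcomeLaw M (bernoulliMeasure u v p))
      (A ∪ {o | ¬ Approximates α μ o}) {o | ENNReal.ofReal T < samplesUsed o}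
    have h3 := measureReal_union_le (μ := outcomeLaw M (bernoulliMeasure u v p))
      A {o | ¬ Approximates α μ o}
    linarith
  · have h : (p : ℝ) - q = μ / R * ((1 - r) / 2) := by
      simp only [p, q]
      ring
    rw [h, abs_mul, abs_div, abs_of_pos hR, abs_of_nonneg (by linarith : 0 ≤ (1 - r) / 2)]
    calc |μ| / R * ((1 - r) / 2) ≤ |μ| / R * (3 * α / 2) :=
          mul_le_mul_of_nonneg_left (by linarith) (by positivity)
      _ = 3 / 2 * (α * |μ| / R) := by ring
  · refine (Nat.floor_le hT0).trans (le_of_eq ?_)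
    rw [hT, ← sq_abs μ]
    field_simp
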